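/- **Setting.** Let $1<p<\infty$ and $T\ge 0$. Let $\Omega\subset\mathbb R^n$ be a bounded open set with Lipschitz boundary and let $M\subset\Omega$ be a compact $C^1$ manifold of dimension $n-1$ with (possibly empty) boundary, oriented by a continuous unit normal field $\nu$, such that $\Omega\setminus M$ is connected. For $u\in W^{1,p}(\Omega\setminus M;\mathbb R^m)$ let $[u]:=u^\oplus-u^\ominus$ be the jump of $u$ on $M$, where $u^\oplus$ and $u^\ominus$ are the traces of $u$ on the positive side of $M$ (the one to which $\nu$ points) and on the negative side. Let $\varphi\colon M\times\mathbb R^m\to[0,+\infty]$ be a Borel function such that, for $\mathscr H^{n-1}$-a.e. $x\in M$, $\varphi(x,0)=0$ and $y\mapsto\varphi(x,y)$ is lower semicontinuous on $\mathbb R^m$; put $\phi([u])(x):=\varphi(x,[u](x))$. Let $L^0(M)^+$ be the set of extended real valued measurable functions on $M$ that are $\ge 0$ $\mathscr H^{n-1}$-a.e. on $M$, where functions that agree $\mathscr H^{n-1}$-a.e. are identified. A map $t\mapsto\gamma(t)$ from $[0,T]$ into $L^0(M)^+$ is *increasing* if $\gamma(s)\le\gamma(t)$ $\mathscr H^{n-1}$-a.e.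 on $M$ whenever $0\le s\le t\le T$. For $\gamma_k,\gamma\in L^0(M)^+$ we say that $\gamma_k$ *$\sigma^p_\varphi$-converges* to $\gamma$ if (a) whenever $u_j\rightharpoonup u$ weakly in $W^{1,p}(\Omega\setminus M;\mathbb R^m)$ and $\phi([u_j])\le\gamma_{k_j}$ $\mathscr H^{n-1}$-a.e. on $M$ for every $j$, for some sequence $k_j\to\infty$, then $\phi([u])\le\gamma$ $\mathscr H^{n-1}$-a.e. on $M$; (b) there are a sequence $u^i\in W^{1,p}(\Omega\setminus M;\mathbb R^m)$ with $\sup_i\phi([u^i])=\gamma$ $\mathscr H^{n-1}$-a.e. on $M$ and, for every $i$, a sequence $u^i_k\in W^{1,p}(\Omega\setminus M;\mathbb R^m)$ with $u^i_k\rightharpoonup u^i$ weakly in $W^{1,p}(\Omega\setminus M;\mathbb R^m)$ as $k\to\infty$ and $\phi([u^i_k])\le\gamma_k$ $\mathscr H^{n-1}$-a.e. on $M$ for every $i$ and $k$. **Lemma.** Let $t\mapsto\gamma_k(t)$, $k\in\mathbb N$, be a sequence of increasing functions from $[0,T]$ into $L^0(M)^+$. Then there exist a subsequence $\gamma_{k_j}$,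 independent of $t$, and an increasing function $t\mapsto\gamma(t)$ from $[0,T]$ into $L^0(M)^+$ such that $\gamma_{k_j}(t)$ $\sigma^p_\varphi$-converges to $\gamma(t)$ for every $t\in[0,T]$. -/

import Mathlib

open MeasureTheory Filter Topology Set
open scoped ENNReal ContDiff

noncomputable section

namespace CohesiveCrack

/-- The space `ℝⁿ` with its Euclidean structure. -/
abbrev Eucl (n : ℕ) : Type := EuclideanSpace ℝ (Fin n)

/-! ### Geometry of the reference configuration and of the crack path -/

/-- `Ω` has a Lipschitz boundary: near each boundary point there are an axis `e` and a Lipschitz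
function `g` of the component orthogonal to `e` such that `Ω` is locally the region strictly below
the graph of `g`. -/
def HasLipschitzBoundary {n : ℕ} (Ω : Set (Eucl n)) : Prop :=
  ∀ x₀ ∈ frontier Ω, ∃ r : ℝ, 0 < r ∧ ∃ e : Eucl n, ‖e‖ = 1 ∧
    ∃ (K : NNReal) (g : Eucl n → ℝ), LipschitzWith K g ∧
      ∀ y ∈ Metric.ball x₀ r, (y ∈ Ω ↔ inner ℝ e y < g (y - inner ℝ e y • e))

/-- `M` is an embedded `C¹` submanifold of `ℝⁿ` of dimension `n - 1`, with (possibly empty)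
boundary: near each of its points a `C¹` diffeomorphism between open subsets of `ℝⁿ` maps `M`
onto a piece of a coordinate hyperplane (interior points) or of a closed half of a coordinate
hyperplane (the boundary points are those mapped to its edge). -/
def IsC1Hypersurface {n : ℕ} (M : Set (Eucl n)) : Prop :=
  ∀ x ∈ M, ∃ Φ : OpenPartialHomeomorph (Eucl n) (Eucl n), x ∈ Φ.source ∧
    ContDiffOn ℝ 1 Φ Φ.source ∧ ContDiffOn ℝ 1 Φ.symm Φ.target ∧
    ∃ i : Fin n,
      (∀ y ∈ Φ.source, (y ∈ M ↔ Φ y i = 0)) ∨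
      ∃ j : Fin n, j ≠ i ∧ ∀ y ∈ Φ.source, (y ∈ M ↔ Φ y i = 0 ∧ 0 ≤ Φ y j)

/-- An orientation of the hypersurface `M`: a continuous unit normal field. The set
`tangentConeAt ℝ M x` is the tangent space of `M` at `x`. -/
structure IsOrientation {n : ℕ} (M : Set (Eucl n)) (ν : M → Eucl n) : Prop where
  continuous : Continuous ν
  norm_eq_one : ∀ x, ‖ν x‖ = 1
  normal : ∀ x : M, ∀ v ∈ tangentConeAt ℝ M (x : Eucl n), inner ℝ (ν x) v = 0

/-- `Ω` is a bounded open set with Lipschitz boundary, `M ⊆ Ω` is a compact `C¹` manifold of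
dimension `n - 1` with boundary, oriented by `ν`, and `Ω \ M` is connected. -/
structure IsCrackSetting {n : ℕ} (Ω M : Set (Eucl n)) (ν : M → Eucl n) : Prop where
  isOpen : IsOpen Ω
  isBounded : Bornology.IsBounded Ω
  lipschitz : HasLipschitzBoundary Ω
  subset : M ⊆ Ω
  isCompact : IsCompact M
  hypersurface : IsC1Hypersurface M
  orientation : IsOrientation M ν
  connected : IsConnected (Ω \ M)

/-! ### The Sobolev space `W^{1,p}(U; ℝᵐ)` -/

/-- `G` is the weak gradient of `u` on the open set `U`:
`∫_U ∂_v ζ u dx = - ∫_U ζ (G v) dx` for every `ζ ∈ C_c^∞(U)` and every direction `v`. -/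
def IsWeakGradient {n m : ℕ} (U : Set (Eucl n)) (u : Eucl n → Eucl m)
    (G : Eucl n → (Eucl n →L[ℝ] Eucl m)) : Prop :=
  ∀ ζ : Eucl n → ℝ, ContDiff ℝ ∞ ζ → HasCompactSupport ζ → tsupport ζ ⊆ U → ∀ v : Eucl n,
    ∫ x in U, (fderiv ℝ ζ x v) • u x = - ∫ x in U, ζ x • (G x v)

theorem integrable_test_left {n m : ℕ} {p : ℝ≥0∞} [hp : Fact (1 ≤ p)] {U : Set (Eucl n)}
    (u : Lp (Eucl m) p (volume.restrict U)) {ζ : Eucl n → ℝ} (hζ : ContDiff ℝ ∞ ζ)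
    (hc : HasCompactSupport ζ) (v : Eucl n) :
    IntegrableOn (fun x => (fderiv ℝ ζ x v) • u x) U := by
  refine ((Lp.memLp u).locallyIntegrable hp.out).integrable_smul_left_of_hasCompactSupport
    ?_ ?_
  · exact (hζ.continuous_fderiv (by simp)).clm_apply continuous_const
  · exact hc.fderiv_apply (𝕜 := ℝ) v

theorem integrable_test_right {n m : ℕ} {p : ℝ≥0∞} [hp : Fact (1 ≤ p)] {U : Set (Eucl n)}
    (G : Lp (Eucl n →L[ℝ] Eucl m) p (volume.restrict U)) {ζ : Eucl n → ℝ}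
    (hζ : ContDiff ℝ ∞ ζ) (hc : HasCompactSupport ζ) (v : Eucl n) :
    IntegrableOn (fun x => ζ x • (G x v)) U := by
  have h := ((Lp.memLp G).locallyIntegrable hp.out).integrable_smul_left_of_hasCompactSupport
    hζ.continuous hc
  exact h.apply_continuousLinearMap v

/-- The Sobolev space `W^{1,p}(U; ℝᵐ)`, realised as the space of pairs `(u, ∇u)` in
`L^p(U; ℝᵐ) × L^p(U; Lin(ℝⁿ, ℝᵐ))`, with the norm of the product (a norm equivalent to the usual
one; the second component is determined by the first). -/
def Sobolev {n : ℕ} (m : ℕ) (p : ℝ≥0∞) [Fact (1 ≤ p)] (U : Set (Eucl n)) :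
    Submodule ℝ (Lp (Eucl m) p (volume.restrict U) ×
      Lp (Eucl n →L[ℝ] Eucl m) p (volume.restrict U)) where
  carrier := {w | IsWeakGradient U w.1 w.2}
  zero_mem' := by
    intro ζ _ _ _ v
    have h1 : ∫ x in U, (fderiv ℝ ζ x v) • (0 : Lp (Eucl m) p (volume.restrict U)) x = 0 := by
      refine integral_eq_zero_of_ae ?_
      filter_upwards [Lp.coeFn_zero (Eucl m) p (volume.restrict U)] with x hx
      rw [hx]
      simp
    have h2 : ∫ x in U,
        ζ x • ((0 : Lp (Eucl n →L[ℝ] Eucl m) p (volume.restrict U)) x v) = 0 := by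
      refine integral_eq_zero_of_ae ?_
      filter_upwards [Lp.coeFn_zero (Eucl n →L[ℝ] Eucl m) p (volume.restrict U)] with x hx
      rw [hx]
      simp
    simp only [Prod.fst_zero, Prod.snd_zero, h1, h2, neg_zero]
  add_mem' := by
    intro a b ha hb ζ hζ hc hs v
    have h1 : ∫ x in U, (fderiv ℝ ζ x v) • (a.1 + b.1 : Lp (Eucl m) p (volume.restrict U)) x
        = (∫ x in U, (fderiv ℝ ζ x v) • a.1 x) + ∫ x in U, (fderiv ℝ ζ x v) • b.1 x := by
      rw [← integral_add (integrable_test_left a.1 hζ hc v) (integrable_test_left b.1 hζ hc v)]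
      refine integral_congr_ae ?_
      filter_upwards [Lp.coeFn_add a.1 b.1] with x hx
      rw [hx]
      simp
    have h2 : ∫ x in U,
        ζ x • ((a.2 + b.2 : Lp (Eucl n →L[ℝ] Eucl m) p (volume.restrict U)) x v)
        = (∫ x in U, ζ x • (a.2 x v)) + ∫ x in U, ζ x • (b.2 x v) := by
      rw [← integral_add (integrable_test_right a.2 hζ hc v)
        (integrable_test_right b.2 hζ hc v)]
      refine integral_congr_ae ?_
      filter_upwards [Lp.coeFn_add a.2 b.2] with x hx
      rw [hx]
      simp
    simp only [Prod.fst_add, Prod.snd_add, h1, h2, ha ζ hζ hc hs v, hb ζ hζ hc hs v, neg_add]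
  smul_mem' := by
    intro c a ha ζ hζ hc hs v
    have h1 : ∫ x in U, (fderiv ℝ ζ x v) • (c • a.1 : Lp (Eucl m) p (volume.restrict U)) x
        = c • ∫ x in U, (fderiv ℝ ζ x v) • a.1 x := by
      rw [← integral_smul]
      refine integral_congr_ae ?_
      filter_upwards [Lp.coeFn_smul c a.1] with x hx
      rw [hx]
      simp [smul_comm c]
    have h2 : ∫ x in U,
        ζ x • ((c • a.2 : Lp (Eucl n →L[ℝ] Eucl m) p (volume.restrict U)) x v)
        = c • ∫ x in U, ζ x • (a.2 x v) := by
      rw [← integral_smul]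
      refine integral_congr_ae ?_
      filter_upwards [Lp.coeFn_smul c a.2] with x hx
      rw [hx]
      simp [smul_comm c]
    simp only [Prod.smul_fst, Prod.smul_snd, h1, h2, ha ζ hζ hc hs v, smul_neg]

/-- Weak convergence of a sequence in a normed space: convergence against every continuous linear
functional. -/
def WeaklyConverges {X : Type*} [NormedAddCommGroup X] [NormedSpace ℝ X] (u : ℕ → X) (v : X) :
    Prop :=
  ∀ l : X →L[ℝ] ℝ, Tendsto (fun j => l (u j)) atTop (𝓝 (l v))

/-! ### Traces on the two sides of `M` and the jump -/

/-- The half ball `{y ∈ B_r(x) : e · (y - x) > 0}`. -/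
def halfBall {n : ℕ} (x e : Eucl n) (r : ℝ) : Set (Eucl n) :=
  {y | y ∈ Metric.ball x r ∧ 0 < inner ℝ e (y - x)}

/-- `a` is the trace of `u` at `x` from the side to which the unit vector `e` points: the average
of `|u - a|` over the half ball `{y ∈ B_r(x) : e · (y - x) > 0}` tends to `0` as `r → 0+`. -/
def IsSideTrace {n m : ℕ} (u : Eucl n → Eucl m) (x e : Eucl n) (a : Eucl m) : Prop :=
  Tendsto (fun r : ℝ => ⨍⁻ y in halfBall x e r, ‖u y - a‖ₑ ∂volume) (𝓝[>] 0) (𝓝 0)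

open Classical in
/-- The one-sided trace of `u` at `x` (set to `0` where there is none; for a Sobolev function on
`Ω \ M` the traces on both sides of `M` exist at almost every point of `M`). -/
def sideTrace {n m : ℕ} (u : Eucl n → Eucl m) (x e : Eucl n) : Eucl m :=
  if h : ∃ a, IsSideTrace u x e a then h.choose else 0

/-- The jump `[u] = u^⊕ - u^⊖` on `M`; the positive side is the one to which `ν` points. -/
def jump {n m : ℕ} {M : Set (Eucl n)} (ν : M → Eucl n) (u : Eucl n → Eucl m) (x : M) : Eucl m :=
  sideTrace u x (ν x) - sideTrace u x (-ν x)

/-! ### Internal variables and `σ^p_φ`-convergence -/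

/-- `L⁰(M)⁺`: nonnegative extended real valued measurable functions on `M`, up to equality
almost everywhere for the `(n - 1)`-dimensional Hausdorff measure; `≤` is inequality almost
everywhere. -/
abbrev L0plus {n : ℕ} (M : Set (Eucl n)) : Type :=
  M →ₘ[Measure.hausdorffMeasure ((n : ℝ) - 1)] ℝ≥0∞

/-- The assumptions on the density `φ : M × ℝᵐ → [0, ∞]`. -/
structure IsCrackDensity {n m : ℕ} {M : Set (Eucl n)} (φ : M → Eucl m → ℝ≥0∞) : Prop where
  borel : Measurable (fun z : M × Eucl m => φ z.1 z.2)
  zero : ∀ᵐ x ∂(Measure.hausdorffMeasure ((n : ℝ) - 1) : Measure M), φ x 0 = 0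
  lsc : ∀ᵐ x ∂(Measure.hausdorffMeasure ((n : ℝ) - 1) : Measure M), LowerSemicontinuous (φ x)

section

variable {n m : ℕ} {p : ℝ≥0∞} [Fact (1 ≤ p)] {Ω M : Set (Eucl n)}

/-- The function `φ([u])` on `M`, for `u ∈ W^{1,p}(Ω \ M; ℝᵐ)`. -/
def crackEnergy (φ : M → Eucl m → ℝ≥0∞) (ν : M → Eucl n) (u : Sobolev m p (Ω \ M)) (x : M) :
    ℝ≥0∞ :=
  φ x (jump ν (u.1.1 : Eucl n → Eucl m) x)

/-- `φ([u]) ≤ γ` almost everywhere on `M`. -/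
def CrackLE (φ : M → Eucl m → ℝ≥0∞) (ν : M → Eucl n) (u : Sobolev m p (Ω \ M))
    (γ : L0plus M) : Prop :=
  ∀ᵐ x ∂(Measure.hausdorffMeasure ((n : ℝ) - 1) : Measure M), crackEnergy φ ν u x ≤ γ x

variable (p Ω) in
/-- `γ_k` `σ^p_φ`-converges to `γ`. -/
structure SigmaConverges (φ : M → Eucl m → ℝ≥0∞) (ν : M → Eucl n) (γk : ℕ → L0plus M)
    (γ : L0plus M) : Prop where
  limit_le : ∀ (u : ℕ → Sobolev m p (Ω \ M)) (v : Sobolev m p (Ω \ M)) (k : ℕ → ℕ),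
    Tendsto k atTop atTop → WeaklyConverges u v → (∀ j, CrackLE φ ν (u j) (γk (k j))) →
      CrackLE φ ν v γ
  recovery : ∃ (v : ℕ → Sobolev m p (Ω \ M)) (w : ℕ → ℕ → Sobolev m p (Ω \ M)),
    (∀ᵐ x ∂(Measure.hausdorffMeasure ((n : ℝ) - 1) : Measure M),
      ⨆ i, crackEnergy φ ν (v i) x = γ x) ∧
    (∀ i, WeaklyConverges (w i) (v i)) ∧ ∀ i k, CrackLE φ ν (w i k) (γk k)

end

end CohesiveCrack

end

/-! Let `K k t` be the set of all `u` in the Sobolev space with `φ([u]) ≤ γ k t` a.e. on `M`. These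
sets increase with `t` and contain `0`. A selection argument of Helly type
(`exists_subseq_weakLimitSet`) gives a single subsequence such that, for every `t`, each weak limit
taken along further indices already lies in the weak lower limit `L t` of the sets. The limit
variable at `t` is the essential supremum of `φ([v])` over `v ∈ L t`. Condition (a) holds because
the limit lies in `L t`. Condition (b) holds because the essential supremum is attained along a
sequence in `L t` (`exists_seq_forall_ae_le_iSup`), each term of which comes with its recovery
sequence. Monotonicity in `t` passes from `K k` to `L`.

For the selection, take a dense sequence in the dual and use it to map the space into `ℕ → ℝ`; on
bounded sets, convergence of the images is weak convergence. For a radius and a basic open set of `ℕ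
→ ℝ`, the times at which `K k t` meets the corresponding set form an upper set of `[0, T]`,
described by a threshold and by whether the threshold belongs to it. Only countably many thresholds
occur, so compactness stabilises all these memberships at once.

Three facts support this: the dual of the Sobolev space is separable, since the dual of `L^p` is an
image of `L^q`; the Hausdorff measure of `M` is finite; and `φ([u])` is measurable, because
one-sided traces depend measurably on the point. -/

namespace CohesiveCrack

/-! ### Duality and separability for `L^p` of a finite measure -/

section LpDual

variable {α : Type*} [MeasurableSpace α] {μ : Measure α} [IsFiniteMeasure μ] {p : ℝ≥0∞}
  [Fact (1 ≤ p)]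

theorem Lp_clm_ext (hp : p ≠ ⊤) {l₁ l₂ : Lp ℝ p μ →L[ℝ] ℝ}
    (h : ∀ s (hs : MeasurableSet s), l₁ (indicatorConstLp p hs (measure_ne_top μ s) 1) =
      l₂ (indicatorConstLp p hs (measure_ne_top μ s) 1)) : l₁ = l₂ := by
  ext f
  induction f using Lp.induction hp with
  | @indicatorConst c s hs hμs =>
    have : ∀ c : ℝ, (indicatorConstLp p hs hμs.ne c : Lp ℝ p μ)
        = c • indicatorConstLp p hs hμs.ne 1 := by
      intro c
      refine Lp.ext ?_
      filter_upwards [indicatorConstLp_coeFn (p := p) (hs := hs) (hμs := hμs.ne) (c := c),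
        indicatorConstLp_coeFn (p := p) (hs := hs) (hμs := hμs.ne) (c := (1 : ℝ)),
        Lp.coeFn_smul c (indicatorConstLp p hs hμs.ne (1 : ℝ))] with x h1 h2 h3
      rw [h1, h3, Pi.smul_apply, h2]
      by_cases hx : x ∈ s <;> simp [hx]
    rw [Lp.simpleFunc.coe_indicatorConst, this, map_smul, map_smul, h _ hs]
  | add hf hg _ h1 h2 => rw [map_add, map_add, h1, h2]
  | isClosed => exact isClosed_eq l₁.continuous l₂.continuous

/-- The part of the union left out by finitely many sets has measure tending to `0`, so for `p < ∞`
the indicators of the partial unions converge in `L^p`. -/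
theorem hasSum_clm_indicatorConstLp (hp : p ≠ ⊤) (l : Lp ℝ p μ →L[ℝ] ℝ) {f : ℕ → Set α}
    (hf : ∀ i, MeasurableSet (f i)) (hd : Pairwise (Function.onFun Disjoint f)) :
    HasSum (fun i => l (indicatorConstLp p (hf i) (measure_ne_top μ _) 1))
      (l (indicatorConstLp p (MeasurableSet.iUnion hf) (measure_ne_top μ _) 1)) := by
  have hm : ∀ s : Finset ℕ, MeasurableSet (⋃ i ∈ s, f i) := fun s =>
    s.measurableSet_biUnion fun i _ => hf i
  have hsum : ∀ s : Finset ℕ, ∑ i ∈ s, l (indicatorConstLp p (hf i) (measure_ne_top μ _) 1)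
      = l (indicatorConstLp p (hm s) (measure_ne_top μ _) 1) := by
    intro s
    rw [← map_sum]
    congr 1
    refine Lp.ext ?_
    have h1 : ∀ᵐ x ∂μ, ∀ i, (indicatorConstLp p (hf i) (measure_ne_top μ (f i)) (1 : ℝ)) x
        = (f i).indicator (fun _ => (1 : ℝ)) x :=
      ae_all_iff.2 fun i => indicatorConstLp_coeFn
    filter_upwards [h1, indicatorConstLp_coeFn (p := p) (hs := hm s)
      (hμs := measure_ne_top μ _) (c := (1 : ℝ)),
      Lp.coeFn_finsetSum s fun i => indicatorConstLp p (hf i) (measure_ne_top μ (f i)) (1 : ℝ)]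
      with x h1 h2 h3
    rw [h2, h3, Finset.sum_apply]
    simp only [h1]
    rw [Finset.indicator_biUnion_apply]
    exact fun i _ j _ hij => hd hij
  rw [HasSum]
  simp only [SummationFilter.unconditional_filter]
  rw [show (fun s : Finset ℕ => ∑ i ∈ s, l (indicatorConstLp p (hf i) (measure_ne_top μ _) 1))
    = fun s => l (indicatorConstLp p (hm s) (measure_ne_top μ _) 1) from funext hsum]
  refine (l.continuous.tendsto _).comp (tendsto_indicatorConstLp_set hp ?_)
  have hanti : Antitone fun s : Finset ℕ => (⋃ i, f i) \ ⋃ i ∈ s, f i := fun s t hst =>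
    sdiff_le_sdiff_left (biUnion_subset_biUnion_left hst)
  have := tendsto_measure_iInter_atTop (μ := μ)
    (fun s => ((MeasurableSet.iUnion hf).diff (hm s)).nullMeasurableSet) hanti
    ⟨∅, measure_ne_top μ _⟩
  have hempty : ⋂ s : Finset ℕ, (⋃ i, f i) \ ⋃ i ∈ s, f i = ∅ := by
    refine eq_empty_of_forall_notMem fun x hx => ?_
    rw [mem_iInter] at hx
    obtain ⟨i, hi⟩ := mem_iUnion.1 (hx ∅).1
    exact (hx {i}).2 (by simpa using hi)
  rw [hempty, measure_empty] at this
  refine this.congr fun s => ?_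
  have : (⋃ i ∈ s, f i) ⊆ ⋃ i, f i := iUnion₂_subset fun i _ => subset_iUnion f i
  simp only [Function.comp]
  rw [symmDiff_of_le this]

-- The values of `l` on indicators form a signed measure that vanishes on `μ`-null sets; its
-- Radon–Nikodym derivative is the density.
open Classical in
theorem exists_integrable_density (hp : p ≠ ⊤) (l : Lp ℝ p μ →L[ℝ] ℝ) :
    ∃ g : α → ℝ, Measurable g ∧ Integrable g μ ∧ ∀ s (hs : MeasurableSet s),
      l (indicatorConstLp p hs (measure_ne_top μ s) 1) = ∫ x in s, g x ∂μ := by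
  let σ : SignedMeasure α :=
    { measureOf' := fun s =>
        if hs : MeasurableSet s then l (indicatorConstLp p hs (measure_ne_top μ s) 1) else 0
      empty' := by simp
      not_measurable' := fun s hs => by simp [hs]
      m_iUnion' := fun f hf hd => by
        simpa [hf, MeasurableSet.iUnion hf] using hasSum_clm_indicatorConstLp hp l hf hd }
  have hσ : ∀ s (hs : MeasurableSet s),
      σ s = l (indicatorConstLp p hs (measure_ne_top μ s) 1) := fun s hs => dif_pos hs
  have hac : σ ≪ᵥ μ.toENNRealVectorMeasure := by
    refine VectorMeasure.AbsolutelyContinuous.mk fun s hs h0 => ?_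
    rw [Measure.toENNRealVectorMeasure_apply_measurable hs] at h0
    rw [hσ s hs]
    have : (indicatorConstLp p hs (measure_ne_top μ s) (1 : ℝ) : Lp ℝ p μ) = 0 := by
      refine Lp.ext ?_
      filter_upwards [indicatorConstLp_coeFn_notMem (p := p) (hs := hs)
        (hμs := measure_ne_top μ s) (c := (1 : ℝ)), Lp.coeFn_zero ℝ p μ,
        measure_eq_zero_iff_ae_notMem.1 h0] with x h1 h2 h3
      rw [h1 h3, h2, Pi.zero_apply]
    rw [this, map_zero]
  refine ⟨σ.rnDeriv μ, σ.measurable_rnDeriv μ, σ.integrable_rnDeriv μ, fun s hs => ?_⟩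
  rw [← hσ s hs, ← withDensityᵥ_apply (σ.integrable_rnDeriv μ) hs,
    σ.withDensityᵥ_rnDeriv_eq μ hac]

theorem lpPairing_indicatorConstLp {q : ℝ≥0∞} [Fact (1 ≤ q)] [q.HolderConjugate p]
    {g : α → ℝ} (hg : MemLp g q μ) {s : Set α} (hs : MeasurableSet s) :
    (ContinuousLinearMap.mul ℝ ℝ).lpPairing μ q p (hg.toLp g)
      (indicatorConstLp p hs (measure_ne_top μ s) 1) = ∫ x in s, g x ∂μ := by
  rw [ContinuousLinearMap.lpPairing_eq_integral, ← integral_indicator hs]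
  refine integral_congr_ae ?_
  filter_upwards [hg.coeFn_toLp, indicatorConstLp_coeFn (p := p) (hs := hs)
        (hμs := measure_ne_top μ s) (c := (1 : ℝ))] with x h1 h2
  rw [h1, h2]
  by_cases hx : x ∈ s <;> simp [hx]

/-- The truncated density is bounded, hence in `L^q`, and can be tested against its dual function.
The bound does not depend on `N`, so it survives the removal of the truncation. -/
theorem eLpNorm_indicator_density_le {q : ℝ≥0∞} [Fact (1 ≤ q)] [q.HolderConjugate p] (hp1 : 1 < p)
    (hp : p ≠ ⊤) (hq1 : 1 < q) (hq : q ≠ ⊤) (l : Lp ℝ p μ →L[ℝ] ℝ) {g : α → ℝ} (hgm : Measurable g)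
    (hl : ∀ s (hs : MeasurableSet s),
      l (indicatorConstLp p hs (measure_ne_top μ s) 1) = ∫ x in s, g x ∂μ) (N : ℕ) :
    eLpNorm ({x | |g x| ≤ N}.indicator g) q μ ≤ ENNReal.ofReal ‖l‖ := by
  set B : Set α := {x | |g x| ≤ N} with hB
  have hBm : MeasurableSet B := measurableSet_le hgm.abs measurable_const
  set h : α → ℝ := B.indicator g with hh
  have hhm : Measurable h := hgm.indicator hBm
  have hhb : ∀ x, |h x| ≤ N := by
    intro x
    by_cases hx : x ∈ B
    · rw [hh, indicator_of_mem hx]; exact hx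
    · rw [hh, indicator_of_notMem hx]; simp
  have hhq : MemLp h q μ := MemLp.of_bound hhm.aestronglyMeasurable N (ae_of_all _ hhb)
  -- restriction to `B`, followed by `l`, is the pairing with `h`
  let R : Lp ℝ p μ →L[ℝ] Lp ℝ p μ := (ContinuousLinearMap.mul ℝ ℝ).holderL μ ⊤ p p
    (indicatorConstLp ⊤ hBm (measure_ne_top μ B) 1)
  have hR : ∀ f : Lp ℝ p μ, R f =ᵐ[μ] B.indicator f := by
    intro f
    filter_upwards [(ContinuousLinearMap.mul ℝ ℝ).coeFn_holder (r := p)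
      (indicatorConstLp ⊤ hBm (measure_ne_top μ B) 1) f,
      indicatorConstLp_coeFn (p := ⊤) (hs := hBm)
        (hμs := measure_ne_top μ B) (c := (1 : ℝ))] with x h1 h2
    change (ContinuousLinearMap.mul ℝ ℝ).holder p
      (indicatorConstLp ⊤ hBm (measure_ne_top μ B) 1) f x = _
    rw [h1, h2]
    by_cases hx : x ∈ B <;> simp [hx]
  have key : l.comp R = (ContinuousLinearMap.mul ℝ ℝ).lpPairing μ q p (hhq.toLp h) := by
    refine Lp_clm_ext hp fun s hs => ?_
    rw [lpPairing_indicatorConstLp hhq hs, hh, setIntegral_indicator hBm, ← hl _ (hs.inter hBm),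
      ContinuousLinearMap.comp_apply]
    congr 1
    refine Lp.ext ?_
    filter_upwards [hR (indicatorConstLp p hs (measure_ne_top μ s) 1),
      indicatorConstLp_coeFn (p := p) (hs := hs)
        (hμs := measure_ne_top μ s) (c := (1 : ℝ)),
      indicatorConstLp_coeFn (p := p) (hs := hs.inter hBm)
        (hμs := measure_ne_top μ _) (c := (1 : ℝ))] with x h1 h2 h3
    rw [h1, h3]
    by_cases hx : x ∈ B <;> by_cases hx' : x ∈ s <;> simp [hx, hx', h2]
  have hP : 1 < p.toReal := by
    rw [← ENNReal.toReal_one]; exact (ENNReal.toReal_lt_toReal (by simp) hp).2 hp1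
  have hQ : 1 < q.toReal := by
    rw [← ENNReal.toReal_one]; exact (ENNReal.toReal_lt_toReal (by simp) hq).2 hq1
  have hPQ : q.toReal.HolderConjugate p.toReal := ENNReal.HolderConjugate.toReal hQ
  set P := p.toReal
  set Q := q.toReal
  -- the dual function
  let f : α → ℝ := fun x => SignType.sign (h x) * |h x| ^ (Q - 1)
  have hfm : Measurable f := by
    have : Measurable fun y : ℝ => ((SignType.sign y : SignType) : ℝ) :=
      Monotone.measurable fun x y hxy => by
        have : SignType.sign x ≤ SignType.sign y := SignType.sign.monotone hxy
        revert this
        generalize SignType.sign x = a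
        generalize SignType.sign y = b
        cases a <;> cases b <;> intro h <;> first | exact absurd h (by decide) | norm_num
    exact (this.comp hhm).mul (hhm.abs.pow_const _)
  have hfabs : ∀ x, |f x| = |h x| ^ (Q - 1) := by
    intro x
    rcases eq_or_ne (h x) 0 with hx | hx
    · simp only [f, hx]
      simp [Real.zero_rpow (sub_pos.2 hQ).ne']
    · rw [abs_mul, abs_of_nonneg (Real.rpow_nonneg (abs_nonneg _) _)]
      have : |((SignType.sign (h x) : SignType) : ℝ)| = 1 := by
        rcases lt_or_gt_of_ne hx with hx | hx <;> simp [hx]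
      rw [this, one_mul]
  have hfb : ∀ x, ‖f x‖ ≤ (N : ℝ) ^ (Q - 1) := fun x => by
    rw [Real.norm_eq_abs, hfabs]
    exact Real.rpow_le_rpow (abs_nonneg _) (hhb x) (sub_pos.2 hQ).le
  have hfp : MemLp f p μ := MemLp.of_bound hfm.aestronglyMeasurable _ (ae_of_all _ hfb)
  have hfh : ∀ x, h x * f x = ‖h x‖ ^ Q := by
    intro x
    rcases eq_or_ne (h x) 0 with hx | hx
    · simp [hx, Real.zero_rpow (zero_lt_one.trans hQ).ne']
    · simp only [f]
      rw [← mul_assoc, self_mul_sign, Real.norm_eq_abs]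
      nth_rewrite 1 [← Real.rpow_one |h x|]
      rw [← Real.rpow_add (abs_pos.2 hx)]
      congr 1
      ring
  set I : ℝ := ∫ x, ‖h x‖ ^ Q ∂μ with hI
  have hI0 : 0 ≤ I := integral_nonneg fun x => Real.rpow_nonneg (norm_nonneg _) _
  have hRf : R (hfp.toLp f) = hfp.toLp f := by
    refine Lp.ext ?_
    filter_upwards [hR (hfp.toLp f), hfp.coeFn_toLp] with x h1 h2
    rw [h1]
    by_cases hx : x ∈ B
    · rw [indicator_of_mem hx]
    · rw [indicator_of_notMem hx, h2]
      simp [f, hh, hx]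
  have e1 : l (hfp.toLp f) = I := by
    have := congrArg (fun L : Lp ℝ p μ →L[ℝ] ℝ => L (hfp.toLp f)) key
    simp only [ContinuousLinearMap.comp_apply, hRf] at this
    rw [this, ContinuousLinearMap.lpPairing_eq_integral]
    refine integral_congr_ae ?_
    filter_upwards [hfp.coeFn_toLp, hhq.coeFn_toLp] with x h1 h2
    rw [h1, h2, ← hfh]
    rfl
  have e2 : ‖hfp.toLp f‖ = I ^ P⁻¹ := by
    rw [Lp.norm_toLp, hfp.eLpNorm_eq_integral_rpow_norm (zero_lt_one.trans hp1).ne' hp,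
      ENNReal.toReal_ofReal (by positivity)]
    congr 1
    refine integral_congr_ae (ae_of_all _ fun x => ?_)
    simp only [Real.norm_eq_abs, hfabs]
    rw [← Real.rpow_mul (abs_nonneg _), hPQ.sub_one_mul_conj]
  have e3 : I ≤ ‖l‖ * I ^ P⁻¹ := by
    rw [← e2, ← e1]; exact (le_abs_self _).trans (l.le_opNorm _)
  rw [hhq.eLpNorm_eq_integral_rpow_norm (zero_lt_one.trans hq1).ne' hq]
  refine ENNReal.ofReal_le_ofReal ?_
  change I ^ Q⁻¹ ≤ ‖l‖
  -- For `I > 0` divide `I ≤ ‖l‖ * I ^ P⁻¹` by `I ^ P⁻¹`, using `Q⁻¹ + P⁻¹ = 1`.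
  rcases hI0.eq_or_lt with h0 | h0
  · rw [← h0, Real.zero_rpow (inv_pos.2 (zero_lt_one.trans hQ)).ne']; exact norm_nonneg _
  · have h1 : I = I ^ Q⁻¹ * I ^ P⁻¹ := by
      rw [← Real.rpow_add h0, hPQ.inv_add_inv_eq_one, Real.rpow_one]
    exact le_of_mul_le_mul_right (h1.symm.le.trans e3) (Real.rpow_pos_of_pos h0 P⁻¹)

/-- Every continuous functional on `L^p` of a finite measure, `1 < p < ∞`, is the pairing with a
function in `L^q`. -/
theorem lpPairing_surjective {q : ℝ≥0∞} [Fact (1 ≤ q)] [q.HolderConjugate p]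
    (hp1 : 1 < p) (hp : p ≠ ⊤) (hq1 : 1 < q) (hq : q ≠ ⊤) :
    Function.Surjective ((ContinuousLinearMap.mul ℝ ℝ).lpPairing μ q p) := by
  intro l
  obtain ⟨g, hgm, -, hl⟩ := exists_integrable_density hp l
  have hgq : MemLp g q μ := by
    refine ⟨hgm.aestronglyMeasurable, ?_⟩
    -- Fatou: the truncations converge pointwise to `g`, and their norms are at most `‖l‖`.
    refine lt_of_le_of_lt (Lp.eLpNorm_lim_le_liminf_eLpNorm
      (f := fun N : ℕ => {x | |g x| ≤ N}.indicator g) (fun N => ?_) g (ae_of_all _ fun x => ?_))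
      (lt_of_le_of_lt (b := ENNReal.ofReal ‖l‖) (liminf_le_of_le (by isBoundedDefault)
        fun b hb => ?_) ENNReal.ofReal_lt_top)
    · exact (hgm.indicator (measurableSet_le hgm.abs measurable_const)).aestronglyMeasurable
    · refine tendsto_const_nhds.congr' ?_
      obtain ⟨N, hN⟩ := exists_nat_ge |g x|
      filter_upwards [eventually_ge_atTop N] with k hk
      rw [indicator_of_mem]
      exact hN.trans (Nat.cast_le.2 hk)
    · obtain ⟨N, hN⟩ := hb.exists
      exact hN.trans (eLpNorm_indicator_density_le hp1 hp hq1 hq l hgm hl N)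
  refine ⟨hgq.toLp g, Lp_clm_ext hp fun s hs => ?_⟩
  rw [lpPairing_indicatorConstLp hgq hs, hl s hs]

/-- The conjugate exponent is finite, so `L^q` is separable, and the pairing maps it continuously
onto the dual. -/
theorem separableSpace_strongDual_Lp_real [IsSeparable μ] (hp1 : 1 < p) (hp : p ≠ ⊤) :
    TopologicalSpace.SeparableSpace (StrongDual ℝ (Lp ℝ p μ)) := by
  have hpq : p.HolderConjugate p.conjExponent :=
    ENNReal.HolderConjugate.conjExponent hp1.le
  have hqp : p.conjExponent.HolderConjugate p := hpq.symm
  have hq : p.conjExponent ≠ ⊤ := by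
    simp [ENNReal.conjExponent, tsub_eq_zero_iff_le, hp1]
  have hq1 : 1 < p.conjExponent := by
    refine ENNReal.lt_add_right (by simp) ?_
    simp [hp]
  have : Fact (1 ≤ p.conjExponent) := ⟨hq1.le⟩
  have : Fact (p.conjExponent ≠ ⊤) := ⟨hq⟩
  exact (lpPairing_surjective (μ := μ) hp1 hp hq1 hq).denseRange.separableSpace
    (ContinuousLinearMap.continuous _)

theorem separableSpace_strongDual_Lp [IsSeparable μ] (hp1 : 1 < p) (hp : p ≠ ⊤)
    (E : Type*) [NormedAddCommGroup E] [NormedSpace ℝ E] [FiniteDimensional ℝ E] :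
    TopologicalSpace.SeparableSpace (StrongDual ℝ (Lp E p μ)) := by
  have := separableSpace_strongDual_Lp_real (μ := μ) hp1 hp
  let b := Module.finBasis ℝ E
  let J : Fin (Module.finrank ℝ E) → Lp ℝ p μ →L[ℝ] Lp E p μ := fun i =>
    (ContinuousLinearMap.toSpanSingleton ℝ (b i)).compLpL p μ
  let C : Fin (Module.finrank ℝ E) → Lp E p μ →L[ℝ] Lp ℝ p μ := fun i =>
    (LinearMap.toContinuousLinearMap (b.coord i)).compLpL p μ
  have hJC : ∀ f : Lp E p μ, ∑ i, J i (C i f) = f := by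
    intro f
    refine Lp.ext ?_
    have h1 : ∀ᵐ x ∂μ, ∀ i, C i f x = b.coord i (f x) := ae_all_iff.2 fun i =>
      ContinuousLinearMap.coeFn_compLp (LinearMap.toContinuousLinearMap (b.coord i)) f
    have h2 : ∀ᵐ x ∂μ, ∀ i, J i (C i f) x = C i f x • b i := ae_all_iff.2 fun i =>
      ContinuousLinearMap.coeFn_compLp (ContinuousLinearMap.toSpanSingleton ℝ (b i)) (C i f)
    filter_upwards [h1, h2, Lp.coeFn_finsetSum Finset.univ fun i => J i (C i f)] with x h1 h2 h3
    rw [h3, Finset.sum_apply]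
    simp only [h2, h1]
    exact b.sum_repr (f x)
  let S : (Fin (Module.finrank ℝ E) → StrongDual ℝ (Lp ℝ p μ)) → StrongDual ℝ (Lp E p μ) :=
    fun l => ∑ i, (l i).comp (C i)
  have hS : Continuous S := continuous_finsetSum _ fun i _ =>
    ((ContinuousLinearMap.compL ℝ (Lp E p μ) (Lp ℝ p μ) ℝ).flip (C i)).continuous.comp
      (continuous_apply i)
  have hsurj : Function.Surjective S := by
    intro l
    refine ⟨fun i => l.comp (J i), ?_⟩
    ext f
    simp only [S, FunLike.coe_sum, Finset.sum_apply, ContinuousLinearMap.comp_apply]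
    rw [← map_sum, hJC]
  exact hsurj.denseRange.separableSpace hS

end LpDual

/-! ### Separability of the dual of the Sobolev space -/

theorem separableSpace_strongDual_prod {E F : Type*} [NormedAddCommGroup E] [NormedSpace ℝ E]
    [NormedAddCommGroup F] [NormedSpace ℝ F]
    [TopologicalSpace.SeparableSpace (StrongDual ℝ E)]
    [TopologicalSpace.SeparableSpace (StrongDual ℝ F)] :
    TopologicalSpace.SeparableSpace (StrongDual ℝ (E × F)) := by
  let S : StrongDual ℝ E × StrongDual ℝ F → StrongDual ℝ (E × F) := fun l =>
    l.1.comp (.fst ℝ E F) + l.2.comp (.snd ℝ E F)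
  have hS : Continuous S :=
    (((ContinuousLinearMap.compL ℝ (E × F) E ℝ).flip (.fst ℝ E F)).continuous.comp
      continuous_fst).add
    (((ContinuousLinearMap.compL ℝ (E × F) F ℝ).flip (.snd ℝ E F)).continuous.comp
      continuous_snd)
  have hsurj : Function.Surjective S := by
    intro l
    refine ⟨(l.comp (.inl ℝ E F), l.comp (.inr ℝ E F)), ?_⟩
    ext x <;> simp [S, ← Prod.zero_eq_mk]
  exact hsurj.denseRange.separableSpace hS

/-- By Hahn–Banach, restriction of functionals to `V` is onto. -/
theorem separableSpace_strongDual_submodule {E : Type*} [NormedAddCommGroup E] [NormedSpace ℝ E]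
    [TopologicalSpace.SeparableSpace (StrongDual ℝ E)] (V : Submodule ℝ E) :
    TopologicalSpace.SeparableSpace (StrongDual ℝ V) := by
  have hsurj : Function.Surjective
      ((ContinuousLinearMap.compL ℝ V E ℝ).flip V.subtypeL) := by
    intro l
    obtain ⟨g, hg, -⟩ := _root_.exists_extension_norm_eq V l
    exact ⟨g, by ext x; exact hg x⟩
  exact hsurj.denseRange.separableSpace (ContinuousLinearMap.continuous _)

theorem separableSpace_strongDual_sobolev {n : ℕ} (m : ℕ) {p : ℝ≥0∞} [Fact (1 ≤ p)] (hp1 : 1 < p)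
    (hp : p ≠ ⊤) {U : Set (Eucl n)} (hU : Bornology.IsBounded U) :
    TopologicalSpace.SeparableSpace (StrongDual ℝ (Sobolev m p U)) := by
  have : IsFiniteMeasure (volume.restrict U) := ⟨by
    rw [Measure.restrict_apply_univ]; exact hU.measure_lt_top⟩
  have := separableSpace_strongDual_Lp (μ := volume.restrict U) hp1 hp (Eucl m)
  have := separableSpace_strongDual_Lp (μ := volume.restrict U) hp1 hp (Eucl n →L[ℝ] Eucl m)
  have := separableSpace_strongDual_prod (E := Lp (Eucl m) p (volume.restrict U))
    (F := Lp (Eucl n →L[ℝ] Eucl m) p (volume.restrict U))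
  exact separableSpace_strongDual_submodule _

/-! ### Helly-type selection for upper sets -/

/-- A sequence of countable families of upper sets of an interval has a subsequence along which
membership of every point is eventually constant. -/
theorem exists_subseq_eventually_mem_or_notMem {ι : Type*} [Countable ι] {T : ℝ}
    (A : ℕ → ι → Set (Icc (0 : ℝ) T)) (hA : ∀ k i, IsUpperSet (A k i)) :
    ∃ κ : ℕ → ℕ, StrictMono κ ∧ ∀ i t,
      (∀ᶠ j in atTop, t ∈ A (κ j) i) ∨ ∀ᶠ j in atTop, t ∉ A (κ j) i := by
  classical
  rcases lt_or_ge T 0 with hT | hT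
  · exact ⟨id, strictMono_id, fun i t => absurd (t.2.1.trans t.2.2) (not_le.2 hT)⟩
  -- Inserting `T` keeps the infimum defined and inside `[0, T]` even when `A k i` is empty.
  set S : ℕ → ι → Set ℝ := fun k i => insert T ((↑) '' A k i)
  have hS0 : ∀ k i, ∀ x ∈ S k i, 0 ≤ x := by
    rintro k i x (rfl | ⟨y, -, rfl⟩)
    exacts [hT, y.2.1]
  have hSb : ∀ k i, BddBelow (S k i) := fun k i => ⟨0, hS0 k i⟩
  set a : ℕ → ι → ℝ := fun k i => sInf (S k i)
  have ha : ∀ k, a k ∈ univ.pi fun _ : ι => Icc (0 : ℝ) T := fun k i _ =>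
    ⟨le_csInf ⟨T, mem_insert _ _⟩ (hS0 k i), csInf_le (hSb k i) (mem_insert _ _)⟩
  have hlt : ∀ k i (t : Icc (0 : ℝ) T), a k i < t → t ∈ A k i := by
    intro k i t h
    obtain ⟨s, hs, hst⟩ := exists_lt_of_csInf_lt ⟨T, mem_insert _ _⟩ h
    rcases hs with rfl | ⟨y, hy, rfl⟩
    · exact absurd t.2.2 (not_le.2 hst)
    · exact hA k i (show y ≤ t from hst.le) hy
  have hgt : ∀ k i (t : Icc (0 : ℝ) T), (t : ℝ) < a k i → t ∉ A k i := fun k i t h ht =>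
    absurd (csInf_le (hSb k i) (mem_insert_of_mem _ ⟨t, ht, rfl⟩)) (not_le.2 h)
  obtain ⟨b, hb, κ, hκ, hconv⟩ :=
    (isCompact_univ_pi fun _ : ι => isCompact_Icc (a := (0 : ℝ)) (b := T)).tendsto_subseq ha
  let c : ι → Icc (0 : ℝ) T := fun i => ⟨b i, hb i trivial⟩
  -- The limits of the thresholds decide every time except the limit threshold `c i` itself; a
  -- second extraction, in `ι → Bool`, settles membership there.
  obtain ⟨d, -, θ, hθ, hconv'⟩ := (isCompact_univ (X := ι → Bool)).tendsto_subseq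
    (x := fun k i => decide (c i ∈ A (κ k) i)) fun _ => trivial
  refine ⟨κ ∘ θ, hκ.comp hθ, fun i t => ?_⟩
  have h1 : Tendsto (fun j => a (κ (θ j)) i) atTop (𝓝 (b i)) :=
    (tendsto_pi_nhds.1 (hconv.comp hθ.tendsto_atTop) i)
  rcases lt_trichotomy (t : ℝ) (b i) with h | h | h
  · exact Or.inr ((h1.eventually (lt_mem_nhds h)).mono fun j hj => hgt _ _ _ hj)
  · have ht : t = c i := Subtype.ext h
    have h2 : ∀ᶠ j in atTop, decide (c i ∈ A (κ (θ j)) i) = d i :=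
      (tendsto_pi_nhds.1 hconv' i).eventually ((isOpen_discrete {d i}).mem_nhds rfl)
    rw [ht]
    cases hd : d i
    · exact Or.inr (h2.mono fun j hj => by simpa [hd] using hj)
    · exact Or.inl (h2.mono fun j hj => by simpa [hd] using hj)
  · exact Or.inl ((h1.eventually (gt_mem_nhds h)).mono fun j hj => hlt _ _ _ hj)

/-! ### Weak convergence and weak lower limits -/

section Weak

variable {X : Type*} [NormedAddCommGroup X] [NormedSpace ℝ X]

/-- Uniform boundedness principle, applied to the images in the bidual. -/
theorem WeaklyConverges.exists_norm_le {u : ℕ → X} {v : X} (h : WeaklyConverges u v) :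
    ∃ R : ℕ, ∀ j, ‖u j‖ ≤ R := by
  obtain ⟨C, hC⟩ := banach_steinhaus
    (g := fun j => NormedSpace.inclusionInDoubleDual ℝ X (u j)) fun l => by
      obtain ⟨C, hC⟩ := (Metric.isBounded_range_of_tendsto _ (h l)).exists_norm_le
      exact ⟨C, fun j => hC _ ⟨j, rfl⟩⟩
  obtain ⟨R, hR⟩ := exists_nat_ge C
  refine ⟨R, fun j => ?_⟩
  have := hC j
  have e : ‖NormedSpace.inclusionInDoubleDual ℝ X (u j)‖ = ‖u j‖ :=
    (NormedSpace.inclusionInDoubleDualLi ℝ).norm_map (u j)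
  exact (e.symm.le.trans this).trans hR

theorem weaklyConverges_of_denseRange {ι : Type*} {l : ι → StrongDual ℝ X} (hl : DenseRange l)
    {u : ℕ → X} {v : X} {R : ℝ} (hR : ∀ j, ‖u j‖ ≤ R)
    (h : ∀ i, Tendsto (fun j => l i (u j)) atTop (𝓝 (l i v))) : WeaklyConverges u v := by
  intro g
  have hC : 0 < |R| + ‖v‖ + 1 := by positivity
  rw [Metric.tendsto_atTop]
  intro ε hε
  obtain ⟨i, hi⟩ := Metric.denseRange_iff.1 hl g (ε / 2 / (|R| + ‖v‖ + 1)) (by positivity)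
  obtain ⟨N, hN⟩ := Metric.tendsto_atTop.1 (h i) (ε / 2) (by positivity)
  refine ⟨N, fun j hj => ?_⟩
  have e1 : ‖(g - l i) (u j - v)‖ ≤ ε / 2 := by
    calc ‖(g - l i) (u j - v)‖ ≤ ‖g - l i‖ * ‖u j - v‖ := (g - l i).le_opNorm _
      _ ≤ ε / 2 / (|R| + ‖v‖ + 1) * (|R| + ‖v‖ + 1) := by
          rw [← dist_eq_norm]
          gcongr
          linarith [norm_sub_le (u j) v, hR j, le_abs_self R]
      _ = ε / 2 := div_mul_cancel₀ _ hC.ne'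
  have e2 := hN j hj
  rw [Real.dist_eq] at e2 ⊢
  have : g (u j) - g v = (g - l i) (u j - v) + (l i (u j) - l i v) := by
    simp
  rw [this]
  exact (abs_add_le _ _).trans_lt (by rw [← Real.norm_eq_abs]; linarith)

/-- The sequential Kuratowski lower limit, in the weak topology, of a sequence of sets. -/
def weakLimitSet (K : ℕ → Set X) : Set X :=
  {v | ∃ w : ℕ → X, (∀ k, w k ∈ K k) ∧ WeaklyConverges w v}

theorem weakLimitSet_mono {K L : ℕ → Set X} (h : ∀ k, K k ⊆ L k) :
    weakLimitSet K ⊆ weakLimitSet L :=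
  fun _ ⟨w, hw, hv⟩ => ⟨w, fun k => h k (hw k), hv⟩

theorem exists_tendsto_of_eventually_inter_nonempty {Y Z : Type*} [PseudoMetricSpace Z]
    (f : Y → Z) (z : Z) (S : ℕ → Set Y) (h : ∀ r > 0, ∀ᶠ k in atTop, ∃ y ∈ S k, dist (f y) z < r) :
    ∃ y : ℕ → Y, (∀ᶠ k in atTop, y k ∈ S k) ∧ Tendsto (fun k => f (y k)) atTop (𝓝 z) := by
  obtain ⟨y₀⟩ : Nonempty Y := by
    obtain ⟨k, y, -⟩ := (h 1 one_pos).exists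
    exact ⟨y⟩
  -- Choose a nearly closest point of each nonempty `S k`, with error `1 / (k + 1)`.
  have hex : ∀ k : ℕ, ∃ y, (S k).Nonempty →
      y ∈ S k ∧ dist z (f y) < Metric.infDist z (f '' S k) + 1 / ((k : ℝ) + 1) := by
    intro k
    by_cases hk : (S k).Nonempty
    · obtain ⟨_, ⟨y, hy, rfl⟩, hyz⟩ := (Metric.infDist_lt_iff (hk.image f)).1
        (lt_add_of_pos_right (Metric.infDist z (f '' S k)) (Nat.one_div_pos_of_nat (n := k)))
      exact ⟨y, fun _ => ⟨hy, hyz⟩⟩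
    · exact ⟨y₀, fun h => absurd h hk⟩
  choose y hy using hex
  have hne : ∀ᶠ k in atTop, (S k).Nonempty :=
    (h 1 one_pos).mono fun k ⟨y, hy, _⟩ => ⟨y, hy⟩
  refine ⟨y, hne.mono fun k hk => (hy k hk).1, ?_⟩
  rw [Metric.tendsto_nhds]
  intro r hr
  filter_upwards [hne, h (r / 2) (half_pos hr),
    tendsto_one_div_add_atTop_nhds_zero_nat.eventually (gt_mem_nhds (half_pos hr))]
    with k hk ⟨y', hy', hyr⟩ hk'
  have h1 := (hy k hk).2
  have h2 : Metric.infDist z (f '' S k) ≤ dist z (f y') :=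
    Metric.infDist_le_dist_of_mem (mem_image_of_mem f hy')
  rw [dist_comm] at hyr ⊢
  linarith

/-- Along a sequence of monotone families of sets that all contain `0`, there is a subsequence for
which weak limits of further subsequences belong to the weak lower limit, for every parameter. -/
theorem exists_subseq_weakLimitSet [TopologicalSpace.SeparableSpace (StrongDual ℝ X)] {T : ℝ}
    (K : ℕ → Icc (0 : ℝ) T → Set X) (hK : ∀ k, Monotone (K k)) (h0 : ∀ k t, (0 : X) ∈ K k t) :
    ∃ κ : ℕ → ℕ, StrictMono κ ∧ ∀ t (u : ℕ → X) (v : X) (k : ℕ → ℕ), Tendsto k atTop atTop →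
      WeaklyConverges u v → (∀ j, u j ∈ K (κ (k j)) t) → v ∈ weakLimitSet fun j => K (κ j) t := by
  classical
  obtain ⟨l, hl⟩ := TopologicalSpace.exists_dense_seq (StrongDual ℝ X)
  let Φ : X → ℕ → ℝ := fun x i => l i x
  let _ : MetricSpace (ℕ → ℝ) := TopologicalSpace.metrizableSpaceMetric _
  let 𝓑 := TopologicalSpace.countableBasis (ℕ → ℝ)
  have h𝓑 : TopologicalSpace.IsTopologicalBasis 𝓑 := TopologicalSpace.isBasis_countableBasis _
  have : Countable 𝓑 := TopologicalSpace.countable_countableBasis _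
  obtain ⟨κ, hκ, hA⟩ := exists_subseq_eventually_mem_or_notMem
    (fun k (i : ℕ × 𝓑) => {t | ∃ x ∈ K k t, ‖x‖ ≤ i.1 ∧ Φ x ∈ (i.2 : Set (ℕ → ℝ))})
    (by rintro k i s t hst ⟨x, hx, h⟩; exact ⟨x, hK k hst hx, h⟩)
  refine ⟨κ, hκ, fun t u v k hk huv hu => ?_⟩
  obtain ⟨R, hR⟩ := huv.exists_norm_le
  have hΦ : Tendsto (fun j => Φ (u j)) atTop (𝓝 (Φ v)) := tendsto_pi_nhds.2 fun i => huv (l i)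
  have hev : ∀ r > 0, ∀ᶠ j in atTop,
      ∃ y ∈ {x | x ∈ K (κ j) t ∧ ‖x‖ ≤ R}, dist (Φ y) (Φ v) < r := by
    intro r hr
    obtain ⟨b, hb, hvb, hbr⟩ := h𝓑.mem_nhds_iff.1 (Metric.ball_mem_nhds (Φ v) hr)
    rcases hA (R, ⟨b, hb⟩) t with h | h
    · filter_upwards [h] with j ⟨x, hx, hxR, hxb⟩
      exact ⟨x, ⟨hx, hxR⟩, hbr hxb⟩
    · exfalso
      -- The sequence `u` itself meets the basic set at arbitrarily late indices, which rules out
      -- eventual absence.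
      obtain ⟨j, hj, hj'⟩ := ((hk.eventually h).and
        (hΦ.eventually ((h𝓑.isOpen hb).mem_nhds hvb))).exists
      exact hj ⟨u j, hu j, hR j, hj'⟩
  obtain ⟨y, hyK, hy⟩ := exists_tendsto_of_eventually_inter_nonempty Φ (Φ v) _ hev
  -- The selected points lie in the sets only eventually; `0` is admissible at the remaining
  -- indices.
  let w : ℕ → X := fun j => if y j ∈ {x | x ∈ K (κ j) t ∧ ‖x‖ ≤ R} then y j else 0
  have hw : ∀ j, w j ∈ K (κ j) t ∧ ‖w j‖ ≤ R := by
    intro j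
    by_cases h : y j ∈ {x | x ∈ K (κ j) t ∧ ‖x‖ ≤ R}
    · simp only [w, if_pos h]; exact h
    · simp only [w, if_neg h]
      exact ⟨h0 _ _, by simp⟩
  refine ⟨w, fun j => (hw j).1, weaklyConverges_of_denseRange hl (fun j => (hw j).2) fun i => ?_⟩
  refine (tendsto_pi_nhds.1 hy i).congr' ?_
  filter_upwards [hyK] with j hj
  rw [show w j = y j from if_pos hj]

end Weak

/-! ### Essential suprema -/

/-- The essential supremum of a family of functions with respect to a finite measure is attained
along a sequence. -/
theorem exists_seq_forall_ae_le_iSup {α ι : Type*} [MeasurableSpace α] {μ : Measure α}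
    [IsFiniteMeasure μ] [Nonempty ι] {f : ι → α → ℝ≥0∞} (hf : ∀ i, AEMeasurable (f i) μ) :
    ∃ s : ℕ → ι, ∀ i, f i ≤ᵐ[μ] fun x => ⨆ k, f (s k) x := by
  -- An increasing injection of `[0, ∞]` into `[0, 1]`, so that the integrals to be maximised are
  -- finite.
  let Θ : ℝ≥0∞ → ℝ≥0∞ := fun x => (ENNReal.orderIsoIicOneBirational x : ℝ≥0∞)
  have hΘ : StrictMono Θ := fun x y h => ENNReal.orderIsoIicOneBirational.strictMono h
  have hΘ1 : ∀ x, Θ x ≤ 1 := fun x => (ENNReal.orderIsoIicOneBirational x).2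
  let J : (ℕ → ι) → ℝ≥0∞ := fun s => ∫⁻ x, Θ (⨆ k, f (s k) x) ∂μ
  have hJ : ∀ s t : ℕ → ι, range s ⊆ range t → ∀ x, ⨆ k, f (s k) x ≤ ⨆ k, f (t k) x := by
    intro s t hst x
    refine iSup_le fun k => ?_
    obtain ⟨j, hj⟩ := hst ⟨k, rfl⟩
    rw [← hj]
    exact le_iSup (fun k => f (t k) x) j
  obtain ⟨v, -, hv, hvJ⟩ := exists_seq_tendsto_sSup (range_nonempty J) (OrderTop.bddAbove _)
  choose s hs using hvJ
  -- Merges all the sequences of a maximising sequence into one, through the pairing of `ℕ × ℕ` with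
  -- `ℕ`.
  let t : ℕ → ι := fun k => s k.unpair.1 k.unpair.2
  have hst : ∀ n, range (s n) ⊆ range t := by
    rintro n _ ⟨k, rfl⟩
    exact ⟨Nat.pair n k, by simp [t]⟩
  have htop : sSup (range J) ≤ J t := by
    refine le_of_tendsto' hv fun n => ?_
    rw [← hs n]
    exact lintegral_mono fun x => hΘ.monotone (hJ _ _ (hst n) x)
  refine ⟨t, fun i => ?_⟩
  -- Prepending `i` cannot raise the maximal integral, so the two suprema agree a.e.
  let t' : ℕ → ι := fun k => Nat.casesOn k i t
  have htt' : range t ⊆ range t' := by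
    rintro _ ⟨k, rfl⟩
    exact ⟨k + 1, rfl⟩
  have hfin : J t ≠ ⊤ := by
    refine ne_top_of_le_ne_top (measure_ne_top μ univ) ?_
    exact (lintegral_mono fun x => hΘ1 _).trans_eq (by simp)
  have hae := ae_eq_of_ae_le_of_lintegral_le (ae_of_all μ fun x => hΘ.monotone (hJ _ _ htt' x))
    hfin (hΘ.monotone.measurable.comp_aemeasurable (AEMeasurable.iSup fun k => hf (t' k)))
    ((le_sSup (mem_range_self (f := J) t')).trans htop)
  filter_upwards [hae] with x hx
  rw [hΘ.injective hx]
  exact le_iSup (fun k => f (t' k) x) 0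

/-! ### Hausdorff measure of a compact hypersurface -/

section Hausdorff

theorem hausdorffMeasure_hyperplane_lt_top {k : ℕ} (i : Fin (k + 1)) {s : Set (Eucl (k + 1))}
    (hs : Bornology.IsBounded s) (h0 : ∀ y ∈ s, y i = 0) :
    Measure.hausdorffMeasure (k : ℝ) s < ⊤ := by
  let g₀ : (Fin k → ℝ) →ₗ[ℝ] Eucl (k + 1) :=
    { toFun := fun y => WithLp.toLp 2 (i.insertNth 0 y)
      map_add' := fun y z => by
        ext j
        refine Fin.succAboveCases i ?_ (fun j => ?_) j <;> simp
      map_smul' := fun c y => by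
        ext j
        refine Fin.succAboveCases i ?_ (fun j => ?_) j <;> simp }
  let g := LinearMap.toContinuousLinearMap g₀
  let π : Eucl (k + 1) → Fin k → ℝ := fun y j => y (i.succAbove j)
  have hg : s ⊆ g '' (π '' s) := by
    rintro y hy
    refine ⟨_, ⟨y, hy, rfl⟩, ?_⟩
    ext j
    refine Fin.succAboveCases i ?_ (fun j => ?_) j
    · simp [g, g₀, h0 y hy]
    · simp [g, g₀, π]
  have hb : Bornology.IsBounded (π '' s) := by
    obtain ⟨C, hC⟩ := hs.exists_norm_le
    refine (isBounded_iff_forall_norm_le).2 ⟨C, ?_⟩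
    rintro _ ⟨y, hy, rfl⟩
    refine (pi_norm_le_iff_of_nonneg ((norm_nonneg y).trans (hC y hy))).2 fun j => ?_
    exact (PiLp.norm_apply_le y _).trans (hC y hy)
  -- In dimension `k` the Hausdorff measure of `Fin k → ℝ` is Lebesgue measure, finite on bounded
  -- sets.
  have hfin : Measure.hausdorffMeasure (k : ℝ) (π '' s) < ⊤ := by
    have := hausdorffMeasure_pi_real (ι := Fin k)
    rw [Fintype.card_fin] at this
    rw [this]
    exact hb.measure_lt_top
  refine (measure_mono hg).trans_lt ((g.lipschitz.hausdorffMeasure_image_le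
    (Nat.cast_nonneg k) _).trans_lt ?_)
  exact ENNReal.mul_lt_top (ENNReal.rpow_lt_top_of_nonneg (Nat.cast_nonneg k) ENNReal.coe_ne_top)
    hfin

/-- Locally `M` is the image of a bounded piece of a hyperplane under the inverse chart, which is
Lipschitz near the point since it is `C¹`; compactness does the rest. -/
theorem IsC1Hypersurface.hausdorffMeasure_lt_top {k : ℕ} {M : Set (Eucl (k + 1))}
    (hM : IsC1Hypersurface M) (hc : IsCompact M) : Measure.hausdorffMeasure (k : ℝ) M < ⊤ := by
  refine hc.measure_lt_top_of_nhdsWithin fun x hx => ?_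
  obtain ⟨Φ, hxΦ, -, hΦ', i, hi⟩ := hM x hx
  have hi0 : ∀ y ∈ Φ.source, y ∈ M → Φ y i = 0 := by
    rcases hi with hi | ⟨j, -, hi⟩
    · exact fun y hy hyM => (hi y hy).1 hyM
    · exact fun y hy hyM => ((hi y hy).1 hyM).1
  have hxt : Φ x ∈ Φ.target := Φ.map_source hxΦ
  obtain ⟨C, t, ht, hC⟩ :=
    (hΦ'.contDiffAt (Φ.open_target.mem_nhds hxt)).exists_lipschitzOnWith
  let N : Set (Eucl (k + 1)) := {y | y ∈ Φ.source ∧ Φ y ∈ t ∩ Metric.ball (Φ x) 1}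
  have hN : N ∈ 𝓝 x := inter_mem (Φ.open_source.mem_nhds hxΦ)
    ((Φ.continuousAt hxΦ).preimage_mem_nhds
      (inter_mem ht (Metric.ball_mem_nhds _ one_pos)))
  refine ⟨M ∩ N, inter_mem self_mem_nhdsWithin (mem_nhdsWithin_of_mem_nhds hN), ?_⟩
  let S : Set (Eucl (k + 1)) := {z | z ∈ t ∩ Metric.ball (Φ x) 1 ∧ z i = 0}
  have hsub : M ∩ N ⊆ Φ.symm '' S := fun y hy =>
    ⟨Φ y, ⟨hy.2.2, hi0 y hy.2.1 hy.1⟩, Φ.left_inv hy.2.1⟩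
  have hS := hausdorffMeasure_hyperplane_lt_top i
    (Metric.isBounded_ball.subset fun z (hz : z ∈ S) => hz.1.2) fun z hz => hz.2
  refine (measure_mono hsub).trans_lt (((hC.mono fun z (hz : z ∈ S) =>
    hz.1.1).hausdorffMeasure_image_le (Nat.cast_nonneg k)).trans_lt ?_)
  exact ENNReal.mul_lt_top (ENNReal.rpow_lt_top_of_nonneg (Nat.cast_nonneg k) ENNReal.coe_ne_top) hS

theorem volume_eq_zero_of_hausdorffMeasure_lt_top {k : ℕ} {M : Set (Eucl (k + 1))}
    (h : Measure.hausdorffMeasure (k : ℝ) M < ⊤) : volume M = 0 := by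
  have h0 : Measure.hausdorffMeasure ((k : ℝ) + 1) M = 0 :=
    (Measure.hausdorffMeasure_zero_or_top (lt_add_one (k : ℝ)) M).resolve_right h.ne
  have hfr : (Module.finrank ℝ (Eucl (k + 1)) : ℝ) = (k : ℝ) + 1 := by simp
  rw [← hfr] at h0
  exact Measure.absolutelyContinuous_isAddHaarMeasure volume
    (Measure.hausdorffMeasure (Module.finrank ℝ (Eucl (k + 1)) : ℝ)) h0

end Hausdorff

/-! ### Measure-theoretic consequences of the geometric setting -/

section Setting

variable {n : ℕ} {Ω M : Set (Eucl n)} {ν : M → Eucl n}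

theorem IsCrackSetting.exists_succ (h : IsCrackSetting Ω M ν) (x : M) : ∃ k, n = k + 1 := by
  obtain ⟨-, -, -, -, i, -⟩ := h.hypersurface x x.2
  exact ⟨n - 1, by have := i.pos; omega⟩

theorem IsCrackSetting.volume_eq_zero (h : IsCrackSetting Ω M ν) : volume M = 0 := by
  rcases M.eq_empty_or_nonempty with h0 | ⟨x, hx⟩
  · rw [h0, measure_empty]
  · obtain ⟨k, rfl⟩ := h.exists_succ ⟨x, hx⟩
    exact volume_eq_zero_of_hausdorffMeasure_lt_top
      (h.hypersurface.hausdorffMeasure_lt_top h.isCompact)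

theorem IsCrackSetting.isFiniteMeasure (h : IsCrackSetting Ω M ν) :
    IsFiniteMeasure (Measure.hausdorffMeasure ((n : ℝ) - 1) : Measure M) := by
  rcases M.eq_empty_or_nonempty with h0 | ⟨x, hx⟩
  · have : IsEmpty M := isEmpty_coe_sort.2 h0
    infer_instance
  · obtain ⟨k, rfl⟩ := h.exists_succ ⟨x, hx⟩
    refine ⟨?_⟩
    have e : (((k + 1 : ℕ) : ℝ) - 1) = k := by push_cast; ring
    rw [e, ← isometry_subtype_coe.hausdorffMeasure_image (Or.inl (Nat.cast_nonneg k)) univ,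
      image_univ, Subtype.range_coe]
    exact h.hypersurface.hausdorffMeasure_lt_top h.isCompact

end Setting

/-! ### Averages over half balls and one-sided traces -/

section HalfBall

variable {n m : ℕ}

theorem isOpen_halfBall (x e : Eucl n) (r : ℝ) : IsOpen (halfBall x e r) :=
  Metric.isOpen_ball.inter (isOpen_lt (f := fun _ => (0 : ℝ)) (g := fun y => inner ℝ e (y - x))
    continuous_const (by fun_prop))

theorem halfBall_mono (x e : Eucl n) {r s : ℝ} (h : r ≤ s) : halfBall x e r ⊆ halfBall x e s :=
  fun _ hy => ⟨Metric.ball_subset_ball h hy.1, hy.2⟩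

theorem volume_halfBall_ne_top (x e : Eucl n) (r : ℝ) : volume (halfBall x e r) ≠ ⊤ :=
  ((measure_mono fun _ hy => hy.1).trans_lt (measure_ball_lt_top (x := x) (r := r))).ne

theorem volume_halfBall_ne_zero (x : Eucl n) {e : Eucl n} (he : ‖e‖ = 1) {r : ℝ} (hr : 0 < r) :
    volume (halfBall x e r) ≠ 0 := by
  refine ((isOpen_halfBall x e r).measure_pos volume ⟨x + (r / 2) • e, ?_, ?_⟩).ne'
  · rw [Metric.mem_ball, dist_self_add_left, norm_smul, he, Real.norm_of_nonneg (by positivity)]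
    linarith
  · rw [add_sub_cancel_left, inner_smul_right, real_inner_self_eq_norm_sq, he]
    positivity

theorem volume_halfBall_half (x e : Eucl n) (r : ℝ) :
    volume (halfBall x e r) ≤ 2 ^ n * volume (halfBall x e (r / 2)) := by
  have hsub : halfBall x e r ⊆ AffineMap.homothety x (2 : ℝ) '' halfBall x e (r / 2) := by
    rintro y ⟨hy1, hy2⟩
    refine ⟨x + (1 / 2 : ℝ) • (y - x), ⟨?_, ?_⟩, ?_⟩
    · rw [Metric.mem_ball, dist_eq_norm] at hy1
      rw [Metric.mem_ball, dist_self_add_left, norm_smul]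
      norm_num
      linarith
    · rw [add_sub_cancel_left, inner_smul_right]
      positivity
    · rw [AffineMap.homothety_apply]
      simp [smul_smul]
  refine (measure_mono hsub).trans_eq ?_
  rw [Measure.addHaar_image_homothety]
  simp

/-- The average of `‖u - a‖` over a half ball. -/
noncomputable def halfBallMean (u : Eucl n → Eucl m) (x e : Eucl n) (a : Eucl m) (r : ℝ) : ℝ≥0∞ :=
  (∫⁻ y in halfBall x e r, ‖u y - a‖ₑ) / volume (halfBall x e r)

theorem isSideTrace_iff_halfBallMean {u : Eucl n → Eucl m} {x e : Eucl n} {a : Eucl m} :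
    IsSideTrace u x e a ↔ Tendsto (halfBallMean u x e a) (𝓝[>] 0) (𝓝 0) := by
  unfold IsSideTrace halfBallMean
  simp only [setLAverage_eq]

/-- Doubling property of half balls; it allows the continuous radius to be replaced by the radii `1
/ (j + 1)`. -/
theorem halfBallMean_le (u : Eucl n → Eucl m) (x e : Eucl n) (a : Eucl m) {r s : ℝ}
    (hrs : s / 2 ≤ r) (hsr : r ≤ s) :
    halfBallMean u x e a r ≤ 2 ^ n * halfBallMean u x e a s := by
  unfold halfBallMean
  rw [← mul_div_assoc, ENNReal.div_eq_inv_mul, ENNReal.div_eq_inv_mul]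
  have h1 : volume (halfBall x e s) ≤ 2 ^ n * volume (halfBall x e r) :=
    (volume_halfBall_half x e s).trans (by gcongr; exact halfBall_mono x e hrs)
  have h2 : (volume (halfBall x e r))⁻¹ ≤ (volume (halfBall x e s))⁻¹ * 2 ^ n := by
    rw [← ENNReal.inv_le_inv, inv_inv,
      ENNReal.mul_inv (Or.inr (by simp)) (Or.inr (by simp)), inv_inv, mul_comm,
      ← ENNReal.div_eq_inv_mul]
    exact ENNReal.div_le_of_le_mul' h1
  calc _ ≤ ((volume (halfBall x e s))⁻¹ * 2 ^ n) * ∫⁻ y in halfBall x e s, ‖u y - a‖ₑ := by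
        gcongr
        exact halfBall_mono x e hsr
    _ = _ := by ring

theorem isSideTrace_iff_tendsto_nat {u : Eucl n → Eucl m} {x e : Eucl n} {a : Eucl m} :
    IsSideTrace u x e a ↔
      Tendsto (fun j : ℕ => halfBallMean u x e a ((j : ℝ) + 1)⁻¹) atTop (𝓝 0) := by
  rw [isSideTrace_iff_halfBallMean]
  constructor
  · intro h
    refine h.comp (tendsto_nhdsWithin_iff.2 ⟨?_, .of_forall fun j => ?_⟩)
    · exact (tendsto_inv_atTop_zero (𝕜 := ℝ)).comp
        (tendsto_atTop_add_const_right _ _ tendsto_natCast_atTop_atTop)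
    · exact inv_pos.2 (by positivity : (0 : ℝ) < (j : ℝ) + 1)
  · intro h
    -- The radius with index `⌊r⁻¹⌋₊ - 1` is `1 / ⌊r⁻¹⌋₊`, which lies between `r` and `2 * r` for `0
    -- < r < 1`.
    have h2 : Tendsto (fun r : ℝ => ⌊r⁻¹⌋₊ - 1) (𝓝[>] 0) atTop :=
      (tendsto_sub_atTop_nat 1).comp
        ((tendsto_nat_floor_atTop (α := ℝ)).comp tendsto_inv_nhdsGT_zero)
    have h3 := ENNReal.Tendsto.const_mul (a := 2 ^ n) (h.comp h2) (Or.inr (by simp))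
    rw [mul_zero] at h3
    refine tendsto_of_tendsto_of_tendsto_of_le_of_le' tendsto_const_nhds h3
      (.of_forall fun _ => zero_le) ?_
    filter_upwards [Ioo_mem_nhdsGT (zero_lt_one (α := ℝ))] with r hr
    have hr1 : 1 ≤ r⁻¹ := (one_le_inv₀ hr.1).2 hr.2.le
    have hf1 : 1 ≤ ⌊r⁻¹⌋₊ := (Nat.one_le_floor_iff _).2 hr1
    have hcast : ((⌊r⁻¹⌋₊ - 1 : ℕ) : ℝ) + 1 = ⌊r⁻¹⌋₊ := by
      rw [Nat.cast_sub hf1]; simp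
    have hf0 : (1 : ℝ) ≤ ⌊r⁻¹⌋₊ := by exact_mod_cast hf1
    have hle : (⌊r⁻¹⌋₊ : ℝ) ≤ r⁻¹ := Nat.floor_le (by positivity)
    have hlt : r⁻¹ < ⌊r⁻¹⌋₊ + 1 := Nat.lt_floor_add_one _
    refine halfBallMean_le u x e a ?_ ?_ <;> simp only [hcast]
    · rw [div_le_iff₀ two_pos, inv_le_iff_one_le_mul₀ (by positivity)]
      have : 1 = r * r⁻¹ := (mul_inv_cancel₀ hr.1.ne').symm
      rw [this]
      nlinarith [hr.1]
    · exact (le_inv_comm₀ hr.1 (by positivity)).2 hle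

theorem limsup_add_le_limsup_add (f g : ℕ → ℝ≥0∞) :
    limsup (fun j => f j + g j) atTop ≤ limsup f atTop + limsup g atTop := by
  simp only [limsup_eq_iInf_iSup_of_nat]
  have hanti : ∀ (u : ℕ → ℝ≥0∞) {i j : ℕ}, i ≤ j → ⨆ k ≥ j, u k ≤ ⨆ k ≥ i, u k :=
    fun u i j hij => iSup₂_le fun k hk => le_iSup₂ (f := fun k _ => u k) k (hij.trans hk)
  rw [ENNReal.iInf_add_iInf fun i j =>
    ⟨max i j, add_le_add (hanti f (le_max_left i j)) (hanti g (le_max_right i j))⟩]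
  exact iInf_mono fun i => iSup₂_le fun k hk =>
    add_le_add (le_iSup₂ (f := fun k _ => f k) k hk) (le_iSup₂ (f := fun k _ => g k) k hk)

/-- The upper limit of the averages of `‖u - a‖` over the half balls of radius `1 / (j + 1)`. -/
noncomputable def traceDefect (u : Eucl n → Eucl m) (x e : Eucl n) (a : Eucl m) : ℝ≥0∞ :=
  limsup (fun j : ℕ => halfBallMean u x e a ((j : ℝ) + 1)⁻¹) atTop

theorem isSideTrace_iff_traceDefect {u : Eucl n → Eucl m} {x e : Eucl n} {a : Eucl m} :
    IsSideTrace u x e a ↔ traceDefect u x e a = 0 := by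
  rw [isSideTrace_iff_tendsto_nat, traceDefect]
  refine ⟨fun h => h.limsup_eq, fun h => ?_⟩
  exact tendsto_of_le_liminf_of_limsup_le zero_le h.le

theorem halfBallMean_triangle (u : Eucl n → Eucl m) (x : Eucl n) {e : Eucl n}
    (he : ‖e‖ = 1) (a b : Eucl m) {r : ℝ} (hr : 0 < r) :
    halfBallMean u x e a r ≤ halfBallMean u x e b r + ‖a - b‖ₑ := by
  have h0 := volume_halfBall_ne_zero x he hr
  have ht := volume_halfBall_ne_top x e r
  unfold halfBallMean
  have : ∫⁻ y in halfBall x e r, ‖u y - a‖ₑ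
      ≤ (∫⁻ y in halfBall x e r, ‖u y - b‖ₑ) + ‖a - b‖ₑ * volume (halfBall x e r) := by
    rw [← setLIntegral_const, ← lintegral_add_right _ measurable_const]
    refine lintegral_mono fun y => ?_
    rw [← edist_eq_enorm_sub, ← edist_eq_enorm_sub, ← edist_eq_enorm_sub, edist_comm a b]
    exact edist_triangle _ _ _
  refine (ENNReal.div_le_div_right this _).trans_eq ?_
  rw [ENNReal.add_div, ENNReal.mul_div_cancel_right h0 ht]

theorem enorm_sub_le_halfBallMean {u : Eucl n → Eucl m} (hu : Measurable u) (x : Eucl n)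
    {e : Eucl n} (he : ‖e‖ = 1) (a b : Eucl m) {r : ℝ} (hr : 0 < r) :
    ‖a - b‖ₑ ≤ halfBallMean u x e a r + halfBallMean u x e b r := by
  have h0 := volume_halfBall_ne_zero x he hr
  have ht := volume_halfBall_ne_top x e r
  unfold halfBallMean
  rw [← ENNReal.add_div, ENNReal.le_div_iff_mul_le (Or.inl h0) (Or.inl ht),
    ← setLIntegral_const, ← lintegral_add_left (by fun_prop)]
  refine lintegral_mono fun y => ?_
  rw [← edist_eq_enorm_sub, ← edist_eq_enorm_sub, ← edist_eq_enorm_sub, edist_comm (u y) a]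
  exact edist_triangle _ _ _

theorem traceDefect_triangle (u : Eucl n → Eucl m) (x : Eucl n) {e : Eucl n}
    (he : ‖e‖ = 1) (a b : Eucl m) :
    traceDefect u x e a ≤ traceDefect u x e b + ‖a - b‖ₑ := by
  unfold traceDefect
  calc _ ≤ limsup (fun j : ℕ => halfBallMean u x e b ((j : ℝ) + 1)⁻¹ + ‖a - b‖ₑ) atTop :=
        limsup_le_limsup (.of_forall fun j =>
          halfBallMean_triangle u x he a b (inv_pos.2 (by positivity)))
    _ ≤ _ := (limsup_add_le_limsup_add _ _).trans_eq (by simp)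

theorem enorm_sub_le_traceDefect {u : Eucl n → Eucl m} (hu : Measurable u) (x : Eucl n)
    {e : Eucl n} (he : ‖e‖ = 1) (a b : Eucl m) :
    ‖a - b‖ₑ ≤ traceDefect u x e a + traceDefect u x e b := by
  unfold traceDefect
  calc ‖a - b‖ₑ = limsup (fun _ : ℕ => ‖a - b‖ₑ) atTop := by simp
    _ ≤ limsup (fun j : ℕ => halfBallMean u x e a ((j : ℝ) + 1)⁻¹
          + halfBallMean u x e b ((j : ℝ) + 1)⁻¹) atTop :=
        limsup_le_limsup (.of_forall fun j =>
          enorm_sub_le_halfBallMean hu x he a b (inv_pos.2 (by positivity)))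
    _ ≤ _ := limsup_add_le_limsup_add _ _

theorem IsSideTrace.unique {u : Eucl n → Eucl m} (hu : Measurable u) {x e : Eucl n}
    (he : ‖e‖ = 1) {a b : Eucl m} (ha : IsSideTrace u x e a) (hb : IsSideTrace u x e b) :
    a = b := by
  have := enorm_sub_le_traceDefect hu x he a b
  rw [isSideTrace_iff_traceDefect.1 ha, isSideTrace_iff_traceDefect.1 hb, add_zero] at this
  exact sub_eq_zero.1 (enorm_eq_zero.1 (le_zero_iff.1 this))

theorem IsSideTrace.sideTrace_eq {u : Eucl n → Eucl m} (hu : Measurable u) {x e : Eucl n}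
    (he : ‖e‖ = 1) {a : Eucl m} (ha : IsSideTrace u x e a) : sideTrace u x e = a := by
  have h : ∃ a, IsSideTrace u x e a := ⟨a, ha⟩
  rw [sideTrace, dif_pos h]
  exact h.choose_spec.unique hu he ha

/-- Where a trace exists, the defect measures the distance to it; measurability of the trace is read
off from this. -/
theorem IsSideTrace.traceDefect_eq {u : Eucl n → Eucl m} (hu : Measurable u) {x e : Eucl n}
    (he : ‖e‖ = 1) {a : Eucl m} (ha : IsSideTrace u x e a) (b : Eucl m) :
    traceDefect u x e b = edist a b := by
  rw [isSideTrace_iff_traceDefect] at ha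
  refine le_antisymm ((traceDefect_triangle u x he b a).trans_eq ?_)
    (((edist_eq_enorm_sub a b).le.trans (enorm_sub_le_traceDefect hu x he a b)).trans_eq ?_)
  · rw [ha, zero_add, edist_comm, edist_eq_enorm_sub]
  · rw [ha, zero_add]

/-- A Cauchy criterion that turns existence of a trace into countably many conditions: points with
small defect are close to each other, and their limit has defect `0`. -/
theorem exists_isSideTrace_iff {u : Eucl n → Eucl m} (hu : Measurable u) {x e : Eucl n}
    (he : ‖e‖ = 1) :
    (∃ a, IsSideTrace u x e a) ↔
      ∀ j : ℕ, ∃ k : ℕ, traceDefect u x e (TopologicalSpace.denseSeq (Eucl m) k)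
        < ((j : ℝ≥0∞) + 1)⁻¹ := by
  have hpos : ∀ j : ℕ, 0 < ((j : ℝ≥0∞) + 1)⁻¹ := fun j => ENNReal.inv_pos.2 (by finiteness)
  constructor
  · rintro ⟨a, ha⟩ j
    obtain ⟨_, ⟨k, rfl⟩, hk⟩ := EMetric.mem_closure_iff.1
      (TopologicalSpace.denseRange_denseSeq (Eucl m) a) _ (hpos j)
    exact ⟨k, by rwa [ha.traceDefect_eq hu he]⟩
  · intro h
    choose k hk using h
    set c : ℕ → Eucl m := fun j => TopologicalSpace.denseSeq (Eucl m) (k j)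
    have hlim : Tendsto (fun j : ℕ => ((j : ℝ≥0∞) + 1)⁻¹) atTop (𝓝 0) := by
      have := (tendsto_add_atTop_iff_nat 1).2 ENNReal.tendsto_inv_nat_nhds_zero
      simpa using this
    have hcauchy : CauchySeq c := by
      refine EMetric.cauchySeq_iff_le_tendsto_0.2
        ⟨fun j => ((j : ℝ≥0∞) + 1)⁻¹ + ((j : ℝ≥0∞) + 1)⁻¹, fun i j N hi hj => ?_, ?_⟩
      · rw [edist_eq_enorm_sub]
        refine (enorm_sub_le_traceDefect hu x he _ _).trans
          (add_le_add ((hk i).le.trans ?_) ((hk j).le.trans ?_)) <;> gcongr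
      · simpa using hlim.add hlim
    obtain ⟨a, ha⟩ := cauchySeq_tendsto_of_complete hcauchy
    refine ⟨a, isSideTrace_iff_traceDefect.2 (le_zero_iff.1 ?_)⟩
    have h1 : Tendsto (fun j : ℕ => ((j : ℝ≥0∞) + 1)⁻¹ + edist a (c j)) atTop (𝓝 0) := by
      simpa [edist_comm] using hlim.add (tendsto_iff_edist_tendsto_0.1 ha)
    refine ge_of_tendsto' h1 fun j => ?_
    refine (traceDefect_triangle u x he a (c j)).trans ?_
    rw [edist_eq_enorm_sub]
    gcongr
    exact (hk j).le

end HalfBall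

/-! ### Measurability of traces, jumps and `φ([u])` -/

section Measurability

variable {n m : ℕ} {α : Type*} [MeasurableSpace α]

/-- By the Lindelöf property every open set is a countable union of balls. -/
theorem measurable_of_measurable_edist {E : Type*} [PseudoEMetricSpace E]
    [SecondCountableTopology E] [MeasurableSpace E] [BorelSpace E] {f : α → E}
    (h : ∀ a, Measurable fun x => edist (f x) a) : Measurable f := by
  refine measurable_of_isOpen fun O hO => ?_
  have hex : ∀ y : O, ∃ ε > 0, Metric.eball (y : E) ε ⊆ O := fun y => EMetric.isOpen_iff.1 hO y y.2
  choose ε hε hsub using hex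
  obtain ⟨T, hT, hTO⟩ := TopologicalSpace.isOpen_iUnion_countable
    (fun y : O => Metric.eball (y : E) (ε y)) fun y => Metric.isOpen_eball
  have hO' : O = ⋃ y ∈ T, Metric.eball (y : E) (ε y) := by
    rw [hTO]
    exact Subset.antisymm (fun y hy => mem_iUnion.2 ⟨⟨y, hy⟩, Metric.mem_eball_self (hε _)⟩)
      (iUnion_subset hsub)
  rw [hO', preimage_iUnion₂]
  exact .biUnion hT fun y _ => measurableSet_lt (h y) measurable_const

/-- The half balls form a measurable subset of the product, so Tonelli applies to numerator and
denominator. -/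
theorem measurable_traceDefect {u : Eucl n → Eucl m} (hu : Measurable u) {ξ e : α → Eucl n}
    (hξ : Measurable ξ) (he : Measurable e) (a : Eucl m) :
    Measurable fun x => traceDefect u (ξ x) (e x) a := by
  refine Measurable.limsup fun j => ?_
  set r : ℝ := ((j : ℝ) + 1)⁻¹
  have hS : MeasurableSet {z : α × Eucl n | z.2 ∈ halfBall (ξ z.1) (e z.1) r} := by
    have h1 : Measurable fun z : α × Eucl n => dist z.2 (ξ z.1) :=
      measurable_snd.dist (hξ.comp measurable_fst)
    have h2 : Measurable fun z : α × Eucl n => inner ℝ (e z.1) (z.2 - ξ z.1) :=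
      (he.comp measurable_fst).inner (measurable_snd.sub (hξ.comp measurable_fst))
    exact (measurableSet_lt h1 measurable_const).inter (measurableSet_lt measurable_const h2)
  refine Measurable.div ?_ (measurable_measure_prodMk_left hS)
  have := (((hu.comp measurable_snd).sub_const a).enorm.indicator hS).lintegral_prod_right'
    (ν := (volume : Measure (Eucl n)))
  convert this using 2 with x
  exact (lintegral_indicator (isOpen_halfBall _ _ _).measurableSet _).symm

theorem measurable_sideTrace {u : Eucl n → Eucl m} (hu : Measurable u) {ξ e : α → Eucl n}
    (hξ : Measurable ξ) (he : Measurable e) (he1 : ∀ x, ‖e x‖ = 1) :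
    Measurable fun x => sideTrace u (ξ x) (e x) := by
  classical
  set D : Set α := {x | ∃ a, IsSideTrace u (ξ x) (e x) a} with hD
  have hDm : MeasurableSet D := by
    have : D = ⋂ j : ℕ, ⋃ k : ℕ, {x | traceDefect u (ξ x) (e x)
        (TopologicalSpace.denseSeq (Eucl m) k) < ((j : ℝ≥0∞) + 1)⁻¹} := by
      ext x
      simp only [hD, mem_ofPred_eq, mem_iInter, mem_iUnion]
      exact exists_isSideTrace_iff hu (he1 x)
    rw [this]
    exact .iInter fun j => .iUnion fun k =>
      measurableSet_lt (measurable_traceDefect hu hξ he _) measurable_const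
  refine measurable_of_measurable_edist fun a => ?_
  have : (fun x => edist (sideTrace u (ξ x) (e x)) a)
      = fun x => if x ∈ D then traceDefect u (ξ x) (e x) a else edist 0 a := by
    ext x
    split_ifs with hx
    · obtain ⟨b, hb⟩ := hx
      rw [hb.sideTrace_eq hu (he1 x), hb.traceDefect_eq hu (he1 x)]
    · rw [sideTrace, dif_neg (show ¬ ∃ a, IsSideTrace u (ξ x) (e x) a from hx)]
  rw [this]
  exact (measurable_traceDefect hu hξ he a).ite hDm measurable_const

theorem measurable_jump {M : Set (Eucl n)} {ν : M → Eucl n} (hν : IsOrientation M ν)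
    {u : Eucl n → Eucl m} (hu : Measurable u) : Measurable (jump ν u) :=
  (measurable_sideTrace hu measurable_subtype_coe hν.continuous.measurable hν.norm_eq_one).sub
    (measurable_sideTrace hu measurable_subtype_coe hν.continuous.measurable.neg
      fun x => (norm_neg _).trans (hν.norm_eq_one x))

theorem measurable_crackEnergy {p : ℝ≥0∞} [Fact (1 ≤ p)] {Ω M : Set (Eucl n)} {ν : M → Eucl n}
    (hν : IsOrientation M ν) {φ : M → Eucl m → ℝ≥0∞} (hφ : IsCrackDensity φ)
    (u : Sobolev m p (Ω \ M)) : Measurable (crackEnergy φ ν u) :=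
  hφ.borel.comp (measurable_id.prodMk
    (measurable_jump hν (Lp.stronglyMeasurable u.1.1).measurable))

end Measurability

/-! ### The zero function has no jump -/

section Zero

variable {n m : ℕ}

theorem isSideTrace_zero_of_ae {u : Eucl n → Eucl m} {Ω : Set (Eucl n)} (hΩ : IsOpen Ω)
    (hu : ∀ᵐ y, y ∈ Ω → u y = 0) {x : Eucl n} (hx : x ∈ Ω) (e : Eucl n) :
    IsSideTrace u x e 0 := by
  rw [isSideTrace_iff_halfBallMean]
  obtain ⟨r₀, hr₀, hball⟩ := Metric.isOpen_iff.1 hΩ x hx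
  refine tendsto_const_nhds.congr' ?_
  filter_upwards [Ioo_mem_nhdsGT hr₀] with r hr
  have : ∫⁻ y in halfBall x e r, ‖u y - 0‖ₑ = 0 := by
    rw [← lintegral_zero (μ := volume.restrict (halfBall x e r))]
    refine lintegral_congr_ae ?_
    filter_upwards [ae_restrict_of_ae hu,
      ae_restrict_mem (isOpen_halfBall x e r).measurableSet] with y h1 h2
    rw [h1 (hball (Metric.ball_subset_ball hr.2.le h2.1)), sub_zero, enorm_zero]
  rw [halfBallMean, this, ENNReal.zero_div]

theorem IsCrackSetting.jump_zero {p : ℝ≥0∞} [Fact (1 ≤ p)] {Ω M : Set (Eucl n)} {ν : M → Eucl n}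
    (h : IsCrackSetting Ω M ν) (x : M) :
    jump ν ((0 : Sobolev m p (Ω \ M)).1.1 : Eucl n → Eucl m) x = 0 := by
  set u : Eucl n → Eucl m := ((0 : Sobolev m p (Ω \ M)).1.1 : Eucl n → Eucl m)
  have hum : Measurable u := (Lp.stronglyMeasurable _).measurable
  -- The representative of `0` vanishes only a.e. on `Ω \ M`; since `M` is Lebesgue-null, it
  -- vanishes a.e. on `Ω`.
  have hu : ∀ᵐ y, y ∈ Ω → u y = 0 := by
    have h1 : u =ᵐ[volume.restrict (Ω \ M)] 0 := Lp.coeFn_zero (Eucl m) p _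
    have h2 := (ae_restrict_iff' (h.isOpen.measurableSet.diff
      h.isCompact.isClosed.measurableSet)).1 h1
    filter_upwards [h2, measure_eq_zero_iff_ae_notMem.1 h.volume_eq_zero] with y h3 h4 h5
    exact h3 ⟨h5, h4⟩
  have hν := h.orientation.norm_eq_one x
  rw [jump, (isSideTrace_zero_of_ae h.isOpen hu (h.subset x.2) _).sideTrace_eq hum hν,
    (isSideTrace_zero_of_ae h.isOpen hu (h.subset x.2) _).sideTrace_eq hum
      ((norm_neg _).trans hν), sub_zero]

theorem IsCrackSetting.crackLE_zero {p : ℝ≥0∞} [Fact (1 ≤ p)] {Ω M : Set (Eucl n)}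
    {ν : M → Eucl n} (h : IsCrackSetting Ω M ν) {φ : M → Eucl m → ℝ≥0∞} (hφ : IsCrackDensity φ)
    (γ : L0plus M) : CrackLE φ ν (0 : Sobolev m p (Ω \ M)) γ := by
  filter_upwards [hφ.zero] with x hx
  rw [crackEnergy, h.jump_zero, hx]
  exact zero_le

end Zero

end CohesiveCrack

/-! ### The compactness lemma -/

theorem lemma4p6 {n m : ℕ} (p : ℝ≥0∞) [Fact (1 ≤ p)] (hp1 : 1 < p) (hp : p ≠ ⊤)
    (Ω M : Set (CohesiveCrack.Eucl n)) (ν : M → CohesiveCrack.Eucl n)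
    (hΩM : CohesiveCrack.IsCrackSetting Ω M ν)
    (φ : M → CohesiveCrack.Eucl m → ℝ≥0∞) (hφ : CohesiveCrack.IsCrackDensity φ)
    (T : ℝ) (γ : ℕ → Set.Icc (0 : ℝ) T → CohesiveCrack.L0plus M)
    (hγ : ∀ k, Monotone (γ k)) :
    ∃ (κ : ℕ → ℕ) (γlim : Set.Icc (0 : ℝ) T → CohesiveCrack.L0plus M),
      StrictMono κ ∧ Monotone γlim ∧
      ∀ t, CohesiveCrack.SigmaConverges p Ω φ ν (fun j => γ (κ j) t) (γlim t) := by
  open CohesiveCrack in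
  have := separableSpace_strongDual_sobolev (n := n) m hp1 hp
    (hΩM.isBounded.subset (sdiff_subset (t := M)))
  have := hΩM.isFiniteMeasure
  let K : ℕ → Icc (0 : ℝ) T → Set (Sobolev m p (Ω \ M)) := fun k t => {u | CrackLE φ ν u (γ k t)}
  have hK : ∀ k, Monotone (K k) := by
    intro k s t hst u hu
    filter_upwards [hu, AEEqFun.coeFn_le.2 (hγ k hst)] with x h1 h2
    exact h1.trans h2
  have h0 : ∀ k t, (0 : Sobolev m p (Ω \ M)) ∈ K k t := fun k t => hΩM.crackLE_zero hφ _
  have hm := measurable_crackEnergy (p := p) (Ω := Ω) hΩM.orientation hφ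
  obtain ⟨κ, hκ, hlim⟩ := exists_subseq_weakLimitSet K hK h0
  let L : Icc (0 : ℝ) T → Set (Sobolev m p (Ω \ M)) := fun t => weakLimitSet fun j => K (κ j) t
  have hL : ∀ t, ∃ s : ℕ → L t, ∀ u : L t,
      crackEnergy φ ν u.1 ≤ᵐ[Measure.hausdorffMeasure ((n : ℝ) - 1)]
        fun x => ⨆ i, crackEnergy φ ν (s i).1 x := fun t => by
    -- The constant sequence `0` is admissible, so the essential supremum is over a nonempty family.
    have : Nonempty (L t) := ⟨⟨0, fun _ => 0, fun j => h0 _ _, fun l => tendsto_const_nhds⟩⟩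
    exact exists_seq_forall_ae_le_iSup fun u : L t => (hm u.1).aemeasurable
  choose s hs using hL
  have hsm : ∀ t, AEStronglyMeasurable (fun x => ⨆ i, crackEnergy φ ν (s t i).1 x)
      (Measure.hausdorffMeasure ((n : ℝ) - 1) : Measure M) := fun t =>
    (Measurable.iSup fun i => hm (s t i).1).aestronglyMeasurable
  refine ⟨κ, fun t => AEEqFun.mk _ (hsm t), hκ, fun t t' htt' => ?_, fun t => ⟨?_, ?_⟩⟩
  · rw [AEEqFun.mk_le_mk]
    -- Each `v` in `L t` competes in the essential supremum at `t'`.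
    have hLL : L t ⊆ L t' := weakLimitSet_mono fun j => hK _ htt'
    filter_upwards [ae_all_iff.2 fun i => hs t' ⟨_, hLL (s t i).2⟩] with x hx
    exact iSup_le hx
  · intro u v k hk huv hu
    filter_upwards [hs t ⟨v, hlim t u v k hk huv hu⟩, AEEqFun.coeFn_mk _ (hsm t)] with x h1 h2
    rw [h2]
    exact h1
  · choose w hw using fun i => (s t i).2
    refine ⟨fun i => (s t i).1, w, ?_, fun i => (hw i).2, fun i k => (hw i).1 k⟩
    filter_upwards [AEEqFun.coeFn_mk _ (hsm t)] with x hx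
    exact hx.symm
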